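/- **Setting.** Let $X_1,X_2,\dots$ be random variables on a probability space $(\Omega,\mathcal F,P)$ with values in a measurable space, and $\mathbf X_n=(X_1,\dots,X_n)$. The data are modelled by laws $F_{\theta}$ of sequences, $\theta\in\Theta=\prod_j\Theta_j$ (finitely or infinitely many coordinates, product $\sigma$-algebra); the truth need not be one of the $F_\theta$. For each $n$ the true law and the $F_\theta$-law of the first $n$ observations have densities $p$ and $f_\theta$ with respect to a common reference measure. Let $\pi$ be a prior probability on $\Theta$, $R_n(\theta)=f_\theta(\mathbf X_n)/p(\mathbf X_n)$, $\pi(AR_n)=\int_A R_n\,d\pi$, and let $\pi(A\mid\mathbf X_n)=\pi(AR_n)/\pi(\Theta R_n)$ be the posterior. Put $h(\theta)=\lim_n \frac1n E_P\log\frac{p(\mathbf X_n)}{f_\theta(\mathbf X_n)}\in[0,\infty]$, $h(A)=\operatorname{ess\,inf}_{A}h$, $J(\theta)=h(\theta)-h(\Theta)$, $J(A)=\operatorname{ess\,inf}_AJ$ (essential infima under $\pi$), $I=\{h=\infty\}$. Assume: (S1) $R_n(\theta)$ is jointly measurable in $\theta$ and the data. (S2) For each $\theta$, $\frac1n\log R_n(\theta)\to-h(\theta)$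 $P$-a.s. (S3) The limit defining $h$ exists (possibly $\infty$) and $h$ is measurable. (S4) $\pi(I)<1$. There are measurable sets $\mathcal G_n\subseteq\Theta$ with: (S5) (1) $\pi(\mathcal G_n)\ge1-\alpha e^{-\varsigma n}$ for some $\alpha>0$, $\varsigma>2h(\Theta)$; (2) for every $n$, $P$-a.s., $\frac1k\log R_k(\theta)\to-h(\theta)$ as $k\to\infty$ uniformly over $\theta\in\mathcal G_n\setminus I$ and, if $\pi(\mathcal G_n\cap I)>0$, $\frac1k\log R_k(\theta)\to-\infty$ uniformly over $\pi$-almost all $\theta\in\mathcal G_n\cap I$ (in the sense that for every $K\in\mathbb R$ and all large $k$, $\frac1k\log R_k(\theta)\le K$ for $\pi$-almost all $\theta\in\mathcal G_n\cap I$); (3) $h(\mathcal G_n)\to h(\Theta)$. (S6) For every measurable $A$ with $\pi(A)>0$, $h(A)<\infty$ and every $\delta>0$, $P$-a.s. for all sufficiently large $n$: $\frac1k\log\pi((\mathcal G_n\cap A)R_k)\le\delta+\limsup_{l\to\infty}\frac1l\log\pi((\mathcal G_n\cap A)R_l)$ for all $k\ge n$. (S7) $h(\mathcal G_n\cap A)\to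 h(A)$ for every measurable $A$ with $\pi(A)>0$. **Hypotheses tested.** For $i=1,\dots,m$ test $H_{0i}:\theta_i\in\Theta_{0i}$ against $H_{1i}:\theta_i\in\Theta_{1i}$, where $\Theta_{1i}$ is measurable and $\Theta_{0i}$ is its complement in $\Theta_i$. Each alternative satisfies $\pi(H_{1i})>0$ and $h(H_{1i})<\infty$. For $d\in\{0,1\}^m$ ($d_i=1$: reject $H_{0i}$) let $\Theta(d)=\{\theta:\theta_i\in\Theta_{d_ii},\ i\le m\}$. The true configuration $d^t$ is the unique one of minimal divergence: $J(\Theta(d^t))=J(\Theta)$ and $J(\Theta(d))>0$ for $d\ne d^t$. **Procedure and error.** Let $G_i\subseteq\{1,\dots,m\}$ be the group of hypotheses dependent on the $i$-th one: $i\in G_i$, and $j\in G_i$ if and only if $i\in G_j$. Put $w_{in}(d)=\pi\big(H_{1i}\cap\bigcap_{j\in G_i\setminus\{i\}}H_{d_j,j}\mid\mathbf X_n\big)$. For $\beta\in[0,1)$ the non-marginal procedure chooses, measurably in the data, a maximizer $\hat d=\hat d_{n,\beta}(\mathbf X_n)$ of $\sum_i d_i(w_{in}(d)-\beta)$ over $d\in\{0,1\}^m$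 (ties broken arbitrarily). Its modified positive Bayesian false discovery rate is $$mpBFDR_{\beta,n}=E_P\left[\frac{\sum_i\hat d_i(1-w_{in}(\hat d))}{\max(\sum_i\hat d_i,1)}\ \middle|\ \hat d\neq\mathbf 0\right]$$ (set to $0$ if $P(\hat d\ne\mathbf 0)=0$). **Theorem.** Assume $d^t\neq\mathbf 0$, $d^t\ne\mathbf 1$, and that for some $m_1<m$ each of $G_1,\dots,G_{m_1}$ contains at least one false null hypothesis ($j$ with $d^t_j=1$), all null hypotheses in $G_{m_1+1},\dots,G_m$ are true, and none of $G_{m_1+1},\dots,G_m$ overlaps any of $G_1,\dots,G_{m_1}$. Then for every $n$ the maximum $E_n=\max_{\beta\in[0,1)}mpBFDR_{\beta,n}$ exists, and asymptotically it lies in the closed interval with the endpoints below: $$\frac{1}{\sum_{i=1}^m d^t_i+1}\ \le\ \liminf_{n\to\infty}E_n\ \le\ \limsup_{n\to\infty}E_n\ \le\ \frac{m-m_1}{\sum_{i=1}^m d^t_i+m-m_1}.$$ -/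

import Mathlib

open MeasureTheory ProbabilityTheory Filter Topology Set
open scoped ENNReal

namespace BayesTesting

/-- A decision configuration: `d i = true` means that the `i`-th null hypothesis is rejected. -/
abbrev Decision (m : ℕ) := Fin m → Bool

/-- The binary digit `d_i ∈ {0, 1}` as a real number. -/
def digit (b : Bool) : ℝ := if b then 1 else 0

/-- The number of rejections `∑ d_i`. -/
def rejections {m : ℕ} (d : Decision m) : ℝ := ∑ i, digit (d i)

/-- A Bayesian multiple testing problem. The data `X 0, X 1, …` live on `(Ω, P)`; the postulated
model is a family `F θ` of laws of sequences, `θ` ranging over the product space `∀ j, T j` (with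
finitely or infinitely many coordinates); it need not contain the true law. For each sample size
`n`, the true and the postulated law of the first `n` observations have densities `p n` and
`f n θ` with respect to a common reference measure `ν n`. The tested coordinates are `test i`,
`i < m`; the alternative is `θ_{test i} ∈ H1 i` and the null hypothesis is `θ_{test i} ∉ H1 i`. -/
structure TestingProblem (Ω Ξ : Type*) {ι : Type*} (T : ι → Type*)
    [MeasurableSpace Ω] [MeasurableSpace Ξ] [∀ j, MeasurableSpace (T j)] (m : ℕ) where
  P : Measure Ω
  isProb_P : IsProbabilityMeasure P
  X : ℕ → Ω → Ξ
  measurable_X : ∀ k, Measurable (X k)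
  F : (∀ j, T j) → Measure (ℕ → Ξ)
  isProb_F : ∀ θ, IsProbabilityMeasure (F θ)
  ν : ∀ n : ℕ, Measure (Fin n → Ξ)
  p : ∀ n : ℕ, (Fin n → Ξ) → ℝ≥0∞
  f : ∀ n : ℕ, (∀ j, T j) → (Fin n → Ξ) → ℝ≥0∞
  measurable_p : ∀ n, Measurable (p n)
  measurable_f : ∀ n θ, Measurable (f n θ)
  density_p : ∀ n, P.map (fun ω (k : Fin n) => X k ω) = (ν n).withDensity (p n)
  density_f : ∀ n θ, (F θ).map (fun x (k : Fin n) => x k) = (ν n).withDensity (f n θ)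
  prior : Measure (∀ j, T j)
  isProb_prior : IsProbabilityMeasure prior
  test : Fin m ↪ ι
  H1 : ∀ i : Fin m, Set (T (test i))
  measurable_H1 : ∀ i, MeasurableSet (H1 i)

namespace TestingProblem

variable {Ω Ξ ι : Type*} {T : ι → Type*} [MeasurableSpace Ω] [MeasurableSpace Ξ]
  [∀ j, MeasurableSpace (T j)] {m : ℕ}

/-- The first `n` observations. -/
def data (M : TestingProblem Ω Ξ T m) (n : ℕ) (ω : Ω) : Fin n → Ξ := fun k => M.X k ω

/-- The likelihood ratio `R_n(θ) = f_θ(x) / p(x)`. -/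
noncomputable def R (M : TestingProblem Ω Ξ T m) (n : ℕ) (θ : ∀ j, T j) (x : Fin n → Ξ) : ℝ≥0∞ :=
  M.f n θ x / M.p n x

/-- `(1/n) log R_n(θ)` at the observed data, with `log 0 = -∞`. -/
noncomputable def logR (M : TestingProblem Ω Ξ T m) (n : ℕ) (θ : ∀ j, T j) (ω : Ω) : EReal :=
  ENNReal.log (M.R n θ (M.data n ω)) / (n : EReal)

/-- `π(A R_n) = ∫_A R_n(θ) π(dθ)`. -/
noncomputable def mass (M : TestingProblem Ω Ξ T m) (n : ℕ) (A : Set (∀ j, T j))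
    (x : Fin n → Ξ) : ℝ≥0∞ :=
  ∫⁻ θ in A, M.R n θ x ∂M.prior

/-- `(1/n) log π(A R_n)` at the observed data, with `log 0 = -∞`. -/
noncomputable def logMass (M : TestingProblem Ω Ξ T m) (n : ℕ) (A : Set (∀ j, T j)) (ω : Ω) :
    EReal :=
  ENNReal.log (M.mass n A (M.data n ω)) / (n : EReal)

/-- The posterior probability of `A` given that the first `n` observations are `x`. -/
noncomputable def posterior (M : TestingProblem Ω Ξ T m) (n : ℕ) (A : Set (∀ j, T j))
    (x : Fin n → Ξ) : ℝ :=
  (M.mass n A x / M.mass n univ x).toReal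

/-- `E log (p(X_n) / f_θ(X_n))`, the Kullback-Leibler divergence of the postulated law of the
first `n` observations from the true one. -/
noncomputable def kl (M : TestingProblem Ω Ξ T m) (n : ℕ) (θ : ∀ j, T j) : ℝ≥0∞ :=
  InformationTheory.klDiv (M.P.map (M.data n)) ((M.F θ).map (fun x (k : Fin n) => x k))

/-- The Kullback-Leibler divergence rate `h(θ) = lim (1/n) E log (p(X_n) / f_θ(X_n))`; that the
limit exists is one of the conditions below. -/
noncomputable def h (M : TestingProblem Ω Ξ T m) (θ : ∀ j, T j) : ℝ≥0∞ :=
  limsup (fun n : ℕ => M.kl n θ / (n : ℝ≥0∞)) atTop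

/-- `h(A)`, the essential infimum of `h` over `A` under the prior (`∞` if `A` is a null set). -/
noncomputable def hSet (M : TestingProblem Ω Ξ T m) (A : Set (∀ j, T j)) : ℝ≥0∞ :=
  essInf M.h (M.prior.restrict A)

/-- `J(A)`, the essential infimum over `A` of `J(θ) = h(θ) - h(Θ)`. -/
noncomputable def J (M : TestingProblem Ω Ξ T m) (A : Set (∀ j, T j)) : ℝ≥0∞ :=
  essInf (fun θ => M.h θ - M.hSet univ) (M.prior.restrict A)

/-- The parameters for which the alternative `H_{1i}` holds. -/
def alt (M : TestingProblem Ω Ξ T m) (i : Fin m) : Set (∀ j, T j) := {θ | θ (M.test i) ∈ M.H1 i}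

/-- The parameters for which `H_{d_i, i}` holds. -/
def hyp (M : TestingProblem Ω Ξ T m) (d : Decision m) (i : Fin m) : Set (∀ j, T j) :=
  {θ | θ (M.test i) ∈ M.H1 i ↔ d i = true}

/-- `Θ(d)`, the cell of the parameter space that corresponds to the configuration `d`. -/
def cell (M : TestingProblem Ω Ξ T m) (d : Decision m) : Set (∀ j, T j) := ⋂ i, M.hyp d i

/-- `dt` is the true decision configuration: the one whose cell has minimal divergence from the
true data generating process. -/
def IsTrueConfig (M : TestingProblem Ω Ξ T m) (dt : Decision m) : Prop :=
  M.J (M.cell dt) = M.J univ ∧ ∀ d, d ≠ dt → 0 < M.J (M.cell d)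

/-- Conditions for posterior convergence of a possibly misspecified model; `𝒢` is the sieve. -/
structure PosteriorConditions (M : TestingProblem Ω Ξ T m) (𝒢 : ℕ → Set (∀ j, T j)) : Prop where
  /-- The likelihood ratio is jointly measurable. -/
  measurable_R : ∀ n, Measurable (fun z : (∀ j, T j) × (Fin n → Ξ) => M.R n z.1 z.2)
  /-- The relative asymptotic equipartition property. -/
  aep : ∀ θ, ∀ᵐ ω ∂M.P, Tendsto (fun n => M.logR n θ ω) atTop (𝓝 (-(M.h θ : EReal)))
  /-- The Kullback-Leibler divergence rate exists, possibly infinite. -/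
  tendsto_kl : ∀ θ, Tendsto (fun n : ℕ => M.kl n θ / (n : ℝ≥0∞)) atTop (𝓝 (M.h θ))
  measurable_h : Measurable M.h
  /-- Not almost all postulated models are infinitely far from the truth. -/
  prior_infinite : M.prior {θ | M.h θ = ∞} < 1
  measurable_sieve : ∀ n, MeasurableSet (𝒢 n)
  /-- The prior mass outside the sieve is exponentially small. -/
  prior_sieve : ∃ α ς : ℝ, 0 < α ∧ 2 * M.hSet univ < ENNReal.ofReal ς ∧
    ∀ n : ℕ, 1 - ENNReal.ofReal (α * Real.exp (-ς * n)) ≤ M.prior (𝒢 n)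
  /-- Uniform convergence in the equipartition property over `𝒢 n` where `h` is finite. -/
  uniform_aep : ∀ n, ∀ᵐ ω ∂M.P, ∀ ε : ℝ, 0 < ε → ∀ᶠ k in atTop, ∀ θ ∈ 𝒢 n, M.h θ ≠ ∞ →
    -(M.h θ : EReal) - (ε : EReal) ≤ M.logR k θ ω ∧
      M.logR k θ ω ≤ -(M.h θ : EReal) + (ε : EReal)
  /-- Uniform divergence to `-∞` over almost all of `𝒢 n` where `h` is infinite (void if `h` is
  almost everywhere finite). -/
  uniform_aep_infinite : ∀ n, ∀ᵐ ω ∂M.P, ∀ K : ℝ, ∀ᶠ k in atTop,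
    ∀ᵐ θ ∂M.prior.restrict (𝒢 n), M.h θ = ∞ → M.logR k θ ω ≤ (K : EReal)
  h_sieve : Tendsto (fun n => M.hSet (𝒢 n)) atTop (𝓝 (M.hSet univ))
  /-- Let `τ(B, δ)` be the last sample size `k` with
  `(1/k) log π(B R_k) > δ + limsup_l (1/l) log π(B R_l)`. Almost surely, `n > τ(𝒢 n ∩ A, δ)` for
  all large `n`. -/
  eventually_tau : ∀ A, MeasurableSet A → 0 < M.prior A → M.hSet A < ∞ → ∀ δ : ℝ, 0 < δ →
    ∀ᵐ ω ∂M.P, ∀ᶠ n in atTop, ∀ k ≥ n,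
      M.logMass k (𝒢 n ∩ A) ω ≤
        (δ : EReal) + limsup (fun l => M.logMass l (𝒢 n ∩ A) ω) atTop
  h_sieve_inter : ∀ A, MeasurableSet A → 0 < M.prior A →
    Tendsto (fun n => M.hSet (𝒢 n ∩ A)) atTop (𝓝 (M.hSet A))

/-- `w_{in}(d)`: the posterior probability that `H_{1i}` holds and that `H_{d_j, j}` holds for all
`j ∈ G i` other than `i`. -/
noncomputable def w (M : TestingProblem Ω Ξ T m) (G : Fin m → Finset (Fin m)) (n : ℕ)
    (x : Fin n → Ξ) (i : Fin m) (d : Decision m) : ℝ :=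
  M.posterior n (M.alt i ∩ ⋂ j ∈ (G i).erase i, M.hyp d j) x

/-- The criterion `f_β(d) = ∑ d_i (w_{in}(d) - β)`. -/
noncomputable def criterion (M : TestingProblem Ω Ξ T m) (G : Fin m → Finset (Fin m)) (β : ℝ)
    (n : ℕ) (x : Fin n → Ξ) (d : Decision m) : ℝ :=
  ∑ i, digit (d i) * (M.w G n x i d - β)

/-- `dhat n β` is a non-marginal decision rule with penalizing constant `β` for samples of size
`n`: a measurable function of the data that maximizes the criterion, ties being broken in any
way. -/
def IsNonMarginal (M : TestingProblem Ω Ξ T m) (G : Fin m → Finset (Fin m))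
    (dhat : ∀ n : ℕ, ℝ → (Fin n → Ξ) → Decision m) : Prop :=
  ∀ n, ∀ β ∈ Ico (0 : ℝ) 1, Measurable (dhat n β) ∧
    ∀ x d, M.criterion G β n x d ≤ M.criterion G β n x (dhat n β x)

/-- The modified posterior false discovery rate of a (non-randomized) decision rule `δ`. -/
noncomputable def mFDR (M : TestingProblem Ω Ξ T m) (G : Fin m → Finset (Fin m)) (n : ℕ)
    (δ : (Fin n → Ξ) → Decision m) (x : Fin n → Ξ) : ℝ :=
  (∑ i, digit (δ x i) * (1 - M.w G n x i (δ x))) / max (rejections (δ x)) 1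

/-- The modified positive Bayesian false discovery rate of a decision rule `δ`: the conditional
expectation of `mFDR` given that at least one hypothesis is rejected (`0` if that has
probability zero). -/
noncomputable def mpBFDR (M : TestingProblem Ω Ξ T m) (G : Fin m → Finset (Fin m)) (n : ℕ)
    (δ : (Fin n → Ξ) → Decision m) : ℝ :=
  ∫ ω, M.mFDR G n δ (M.data n ω) ∂(cond M.P {ω | δ (M.data n ω) ≠ fun _ => false})

end TestingProblem

end BayesTesting

/-!
Two facts carry the theorem.

*The maximum is attained at `β = 0`.* A larger penalty never yields more rejections, and comparing
the optimality inequalities of the two decisions shows that, pointwise, it never increases the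
posterior false discovery rate as long as something is rejected. The event on which one conditions
shrinks as `β` grows, but where the decision with the larger penalty `β₂` rejects nothing, the
other one has posterior false discovery rate at least `1 - β₂`, whereas the former never exceeds
this value where it rejects something. So the conditional expectation decreases in `β`, whatever
the rule for ties (`mpBFDR_anti`).

*At `β = 0` the decision is determined up to the second block.* Almost surely the posterior
concentrates on the cell of the true configuration `dt`
(`ae_tendsto_posterior_compl_cell`): on the complement of that cell `h` exceeds its minimum by a
margin, so that there the integrated likelihood ratio decays faster than it does on the whole
space. The upper bound splits the complement along the sieve (`ae_mass_sieve_inter_le`,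
`ae_tendsto_mass_compl_sieve`), the lower bound follows from the equipartition property and
Fubini's theorem (`ae_exists_le_mass`). All the gains `∑ d_i w_{in}(d)` are then close to integers,
and a maximizer must agree with `dt` on every group that contains a false null hypothesis, that is,
on the first `m₁` coordinates. The remaining hypotheses are all true and contribute asymptotically
nothing to the gain, but without a penalty at least one of them is rejected, since some decision
that does so has a strictly larger gain (`exists_gain_true_lt`). So the number of rejections lies
between `∑ dt_i + 1` and `∑ dt_i + m - m₁`, and the posterior false discovery rate is close to one
minus the ratio of `∑ dt_i` to that number (`mFDR_mem_of_concentrated`). It is bounded, so its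
conditional expectation obeys the same asymptotic bounds.
-/

namespace BayesTesting

/-! ### Logarithmic rates of extended nonnegative reals -/

theorem log_div_le_coe_iff {n : ℕ} (hn : 0 < n) (x : ℝ≥0∞) (s : ℝ) :
    ENNReal.log x / (n : EReal) ≤ (s : EReal) ↔ x ≤ ENNReal.ofReal (Real.exp (n * s)) := by
  rw [EReal.div_le_iff_le_mul (by exact_mod_cast hn) (by exact_mod_cast EReal.coe_ne_top (n : ℝ)),
    ← ENNReal.log_le_log_iff, ENNReal.log_ofReal_of_pos (Real.exp_pos _), Real.log_exp,
    EReal.coe_mul]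
  simp

theorem coe_lt_log_div_iff {n : ℕ} (hn : 0 < n) (x : ℝ≥0∞) (s : ℝ) :
    (s : EReal) < ENNReal.log x / (n : EReal) ↔ ENNReal.ofReal (Real.exp (n * s)) < x := by
  rw [← not_le, ← not_le, log_div_le_coe_iff hn]

/-! ### Decisions -/

theorem digit_nonneg (b : Bool) : 0 ≤ digit b := by cases b <;> simp [digit]

theorem digit_le_one (b : Bool) : digit b ≤ 1 := by cases b <;> simp [digit]

theorem rejections_nonneg {m : ℕ} (d : Decision m) : 0 ≤ rejections d :=
  Finset.sum_nonneg fun _ _ => digit_nonneg _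

theorem one_le_rejections {m : ℕ} {d : Decision m} (hd : d ≠ fun _ => false) :
    1 ≤ rejections d := by
  obtain ⟨i, hi⟩ := Function.ne_iff.1 hd
  have h1 : digit (d i) = 1 := by simpa [digit] using hi
  exact h1 ▸ Finset.single_le_sum (f := fun i => digit (d i)) (fun _ _ => digit_nonneg _)
    (Finset.mem_univ i)

@[simp]
theorem rejections_false {m : ℕ} : rejections (fun _ : Fin m => false) = 0 := by
  simp [rejections, digit]

theorem sum_fin_indicator_le {m m₁ : ℕ} (hm : m₁ ≤ m) :
    ∑ i : Fin m, (if m₁ ≤ (i : ℕ) then (1 : ℝ) else 0) = (m : ℝ) - m₁ := by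
  have h1 := Fin.sum_univ_eq_sum_range (fun i : ℕ => if m₁ ≤ i then (1 : ℝ) else 0) m
  have h2 : (Finset.range m).filter (fun i => m₁ ≤ i) = Finset.Ico m₁ m := by
    ext i; simp [and_comm]
  rw [h1, Finset.sum_boole, h2, Nat.card_Ico, Nat.cast_sub hm]

/-! ### Conditional expectations given an event -/

/-- If `f₂ ≤ a` and `f₂ ≤ f₁` on a subset `s₂` of `s₁`, and `a ≤ f₁` on the rest of `s₁`, then the
mean of `f₂` given `s₂` is at most the mean of `f₁` given `s₁`. -/
theorem integral_cond_le_integral_cond {Ω : Type*} [MeasurableSpace Ω] {P : Measure Ω}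
    [IsProbabilityMeasure P] {s₁ s₂ : Set Ω} (h₁ : MeasurableSet s₁) (h₂ : MeasurableSet s₂)
    (hsub : s₂ ⊆ s₁) {f₁ f₂ : Ω → ℝ} (hf₁ : Integrable f₁ P) (hf₂ : Integrable f₂ P)
    (hf₁0 : 0 ≤ f₁) {a : ℝ} (hle : ∀ ω ∈ s₂, f₂ ω ≤ f₁ ω) (hf₂a : ∀ ω ∈ s₂, f₂ ω ≤ a)
    (haf₁ : ∀ ω ∈ s₁ \ s₂, a ≤ f₁ ω) :
    ∫ ω, f₂ ω ∂(cond P s₂) ≤ ∫ ω, f₁ ω ∂(cond P s₁) := by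
  by_cases h0 : P s₂ = 0
  · have : cond P s₂ = 0 := cond_eq_zero_of_meas_eq_zero h0
    rw [this, integral_zero_measure]
    exact integral_nonneg hf₁0
  have hp : 0 < P.real s₂ := ENNReal.toReal_pos h0 (measure_ne_top _ _)
  have hpq : P.real s₂ ≤ P.real s₁ := measureReal_mono hsub
  simp only [ProbabilityTheory.cond, integral_smul_measure, ENNReal.toReal_inv, smul_eq_mul]
  change (P.real s₂)⁻¹ * _ ≤ (P.real s₁)⁻¹ * _
  have hA : ∫ ω in s₂, f₂ ω ∂P ≤ ∫ ω in s₂, f₁ ω ∂P :=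
    setIntegral_mono_on hf₂.integrableOn hf₁.integrableOn h₂ hle
  have hB : ∫ ω in s₂, f₂ ω ∂P ≤ a * P.real s₂ := by
    have := setIntegral_mono_on hf₂.integrableOn (integrable_const a).integrableOn h₂ hf₂a
    rwa [setIntegral_const, smul_eq_mul, mul_comm] at this
  have hC : a * (P.real s₁ - P.real s₂) ≤ ∫ ω in s₁ \ s₂, f₁ ω ∂P := by
    have := setIntegral_mono_on (integrable_const a).integrableOn hf₁.integrableOn
      (h₁.diff h₂) haf₁
    rwa [setIntegral_const, smul_eq_mul, mul_comm, measureReal_sdiff hsub h₂] at this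
  have hD : ∫ ω in s₁, f₁ ω ∂P = ∫ ω in s₂, f₁ ω ∂P + ∫ ω in s₁ \ s₂, f₁ ω ∂P := by
    rw [setIntegral_sdiff h₂ hf₁.integrableOn hsub]; ring
  rw [inv_mul_eq_div, inv_mul_eq_div, div_le_div_iff₀ hp (hp.trans_le hpq), hD]
  nlinarith [mul_nonneg (sub_nonneg.2 hB) (sub_nonneg.2 hpq)]

/-- Means given events `s n` inherit the almost sure asymptotic bounds of functions with values in
`[0, 1]` if almost every point eventually lies in `s n`. -/
theorem eventually_integral_cond_mem {Ω : Type*} [MeasurableSpace Ω] {P : Measure Ω}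
    [IsProbabilityMeasure P] {s : ℕ → Set Ω} (hs : ∀ n, MeasurableSet (s n)) {f : ℕ → Ω → ℝ}
    (hf : ∀ n, Measurable (f n)) (hf0 : ∀ n ω, 0 ≤ f n ω) (hf1 : ∀ n ω, f n ω ≤ 1) {l u : ℝ}
    (hl : l ≤ 1) (hu : 0 ≤ u)
    (hev : ∀ᵐ ω ∂P, ∀ᶠ n in atTop, ω ∈ s n ∧ l ≤ f n ω ∧ f n ω ≤ u) {ε : ℝ} (hε : 0 < ε) :
    ∀ᶠ n in atTop, l - ε < ∫ ω, f n ω ∂(cond P (s n)) ∧ ∫ ω, f n ω ∂(cond P (s n)) < u + ε := by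
  let g : ℕ → Set Ω := fun n => {ω | ω ∈ s n ∧ l ≤ f n ω ∧ f n ω ≤ u}
  have hg : ∀ n, MeasurableSet (g n) := fun n =>
    (hs n).inter ((measurableSet_le measurable_const (hf n)).inter
      (measurableSet_le (hf n) measurable_const))
  have hlim : Tendsto (fun n => P (g n)) atTop (𝓝 1) := by
    have := tendsto_measure_of_ae_tendsto_indicator_of_isFiniteMeasure (μ := P) atTop
      MeasurableSet.univ hg (by
        filter_upwards [hev] with ω hω
        filter_upwards [hω] with n hn
        exact iff_of_true hn (mem_univ _))
    rwa [measure_univ] at this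
  have hlim' : Tendsto (fun n => P.real (g n)) atTop (𝓝 1) := by
    have := (ENNReal.tendsto_toReal ENNReal.one_ne_top).comp hlim
    rwa [ENNReal.toReal_one] at this
  filter_upwards [hlim'.eventually (lt_mem_nhds (show 1 - ε < 1 by linarith)),
    hlim.eventually (lt_mem_nhds zero_lt_one)] with n hn hn0
  have hgs : g n ⊆ s n := fun ω hω => hω.1
  have := cond_isProbabilityMeasure (μ := P) (hn0.trans_le (measure_mono hgs)).ne'
  set Q := cond P (s n) with hQ
  have hPQ : P (g n) ≤ Q (g n) := by
    rw [hQ, cond_apply (hs n), inter_eq_self_of_subset_right hgs]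
    exact le_mul_of_one_le_left' (ENNReal.one_le_inv.2 prob_le_one)
  have hQc : Q.real (g n)ᶜ < ε := by
    have h1 : P.real (g n) ≤ Q.real (g n) := ENNReal.toReal_mono (measure_ne_top _ _) hPQ
    rw [probReal_compl_eq_one_sub (hg n)]
    linarith
  have hint : Integrable (f n) Q := Integrable.of_bound (hf n).aestronglyMeasurable 1
    (ae_of_all _ fun ω => by rw [Real.norm_of_nonneg (hf0 n ω)]; exact hf1 n ω)
  have hi : Integrable ((g n)ᶜ.indicator fun _ => (1 : ℝ)) Q :=
    (integrable_const 1).indicator (hg n).compl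
  have hival : ∫ ω, (g n)ᶜ.indicator (fun _ => (1 : ℝ)) ω ∂Q = Q.real (g n)ᶜ := by
    rw [integral_indicator_const _ (hg n).compl, smul_eq_mul, mul_one]
  have hlow : ∫ ω, (l - (g n)ᶜ.indicator (fun _ => (1 : ℝ)) ω) ∂Q ≤ ∫ ω, f n ω ∂Q := by
    refine integral_mono ((integrable_const l).sub hi) hint fun ω => ?_
    by_cases hω : ω ∈ g n
    · simpa [hω] using hω.2.1
    · simp only [indicator_of_mem (mem_compl hω)]
      linarith [hf0 n ω]
  have hupp : ∫ ω, f n ω ∂Q ≤ ∫ ω, (u + (g n)ᶜ.indicator (fun _ => (1 : ℝ)) ω) ∂Q := by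
    refine integral_mono hint ((integrable_const u).add hi) fun ω => ?_
    by_cases hω : ω ∈ g n
    · simpa [hω] using hω.2.2
    · simp only [indicator_of_mem (mem_compl hω)]
      linarith [hf1 n ω]
  rw [integral_sub (integrable_const l) hi, hival, integral_const, probReal_univ, one_smul] at hlow
  rw [integral_add (integrable_const u) hi, hival, integral_const, probReal_univ, one_smul] at hupp
  constructor <;> linarith

namespace TestingProblem

variable {Ω Ξ ι : Type*} {T : ι → Type*} [MeasurableSpace Ω] [MeasurableSpace Ξ]
  [∀ j, MeasurableSpace (T j)] {m : ℕ} {M : TestingProblem Ω Ξ T m}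
  {𝒢 : ℕ → Set (∀ j, T j)} {dt : Decision m} {G : Fin m → Finset (Fin m)}
  {dhat : ∀ n : ℕ, ℝ → (Fin n → Ξ) → Decision m}

/-! ### Measurability -/

theorem measurable_data (M : TestingProblem Ω Ξ T m) (n : ℕ) : Measurable (M.data n) :=
  measurable_pi_lambda _ fun k => M.measurable_X k

theorem measurableSet_alt (M : TestingProblem Ω Ξ T m) (i : Fin m) : MeasurableSet (M.alt i) :=
  measurable_pi_apply (M.test i) (M.measurable_H1 i)

theorem measurableSet_hyp (M : TestingProblem Ω Ξ T m) (d : Decision m) (i : Fin m) :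
    MeasurableSet (M.hyp d i) := by
  cases hd : d i
  · have : M.hyp d i = (M.alt i)ᶜ := by ext θ; simp [hyp, alt, hd]
    exact this ▸ (M.measurableSet_alt i).compl
  · have : M.hyp d i = M.alt i := by ext θ; simp [hyp, alt, hd]
    exact this ▸ M.measurableSet_alt i

theorem measurableSet_cell (M : TestingProblem Ω Ξ T m) (d : Decision m) :
    MeasurableSet (M.cell d) :=
  MeasurableSet.iInter fun i => M.measurableSet_hyp d i

theorem measurable_mass (hS : M.PosteriorConditions 𝒢) (n : ℕ) (A : Set (∀ j, T j)) :
    Measurable (M.mass n A) := by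
  have := M.isProb_prior
  exact ((hS.measurable_R n).comp measurable_swap).lintegral_prod_right'

theorem measurable_posterior (hS : M.PosteriorConditions 𝒢) (n : ℕ) (A : Set (∀ j, T j)) :
    Measurable (M.posterior n A) :=
  ((measurable_mass hS n A).div (measurable_mass hS n univ)).ennreal_toReal

theorem measurable_R_data (hS : M.PosteriorConditions 𝒢) (n : ℕ) :
    Measurable fun z : (∀ j, T j) × Ω => M.R n z.1 (M.data n z.2) :=
  (hS.measurable_R n).comp (measurable_fst.prodMk ((M.measurable_data n).comp measurable_snd))

/-! ### The posterior as a set function -/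

theorem mass_mono (M : TestingProblem Ω Ξ T m) (n : ℕ) {A B : Set (∀ j, T j)} (h : A ⊆ B)
    (x : Fin n → Ξ) : M.mass n A x ≤ M.mass n B x :=
  lintegral_mono_set h

theorem mass_div_le_one (M : TestingProblem Ω Ξ T m) (n : ℕ) (A : Set (∀ j, T j))
    (x : Fin n → Ξ) : M.mass n A x / M.mass n univ x ≤ 1 :=
  (ENNReal.div_le_div_right (M.mass_mono n (subset_univ A) x) _).trans ENNReal.div_self_le_one

theorem posterior_nonneg (M : TestingProblem Ω Ξ T m) (n : ℕ) (A : Set (∀ j, T j))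
    (x : Fin n → Ξ) : 0 ≤ M.posterior n A x :=
  ENNReal.toReal_nonneg

theorem posterior_le_one (M : TestingProblem Ω Ξ T m) (n : ℕ) (A : Set (∀ j, T j))
    (x : Fin n → Ξ) : M.posterior n A x ≤ 1 :=
  ENNReal.toReal_le_of_le_ofReal zero_le_one (by simpa using M.mass_div_le_one n A x)

theorem posterior_mono (M : TestingProblem Ω Ξ T m) (n : ℕ) {A B : Set (∀ j, T j)} (h : A ⊆ B)
    (x : Fin n → Ξ) : M.posterior n A x ≤ M.posterior n B x :=
  ENNReal.toReal_mono ((M.mass_div_le_one n B x).trans_lt ENNReal.one_lt_top).ne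
    (ENNReal.div_le_div_right (M.mass_mono n h x) _)

theorem posterior_add_posterior_compl (M : TestingProblem Ω Ξ T m) (n : ℕ)
    {A : Set (∀ j, T j)} (hA : MeasurableSet A) (x : Fin n → Ξ) (h0 : M.mass n univ x ≠ 0)
    (ht : M.mass n univ x ≠ ∞) : M.posterior n A x + M.posterior n Aᶜ x = 1 := by
  have hne : ∀ B, M.mass n B x / M.mass n univ x ≠ ∞ := fun B =>
    ((M.mass_div_le_one n B x).trans_lt ENNReal.one_lt_top).ne
  have hadd : M.mass n A x + M.mass n Aᶜ x = M.mass n univ x := by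
    simp only [mass, Measure.restrict_univ]
    exact lintegral_add_compl _ hA
  rw [posterior, posterior, ← ENNReal.toReal_add (hne _) (hne _), ENNReal.div_add_div_same, hadd,
    ENNReal.div_self h0 ht, ENNReal.toReal_one]

theorem posterior_pos (M : TestingProblem Ω Ξ T m) (n : ℕ) {A : Set (∀ j, T j)} {x : Fin n → Ξ}
    (hA : M.mass n A x ≠ 0) (ht : M.mass n univ x ≠ ∞) : 0 < M.posterior n A x :=
  ENNReal.toReal_pos (ENNReal.div_pos hA ht).ne'
    ((M.mass_div_le_one n A x).trans_lt ENNReal.one_lt_top).ne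

/-! ### Bounds for the integrated likelihood ratio -/

/-- The inequality `E_P R_n(θ) ≤ 1`; it can be strict, as the law `F θ` need not be absolutely
continuous with respect to the true one. -/
theorem lintegral_R_le_one (hS : M.PosteriorConditions 𝒢) (n : ℕ) (θ : ∀ j, T j) :
    ∫⁻ ω, M.R n θ (M.data n ω) ∂M.P ≤ 1 := by
  have := M.isProb_F θ
  have hR : Measurable (M.R n θ) := (hS.measurable_R n).comp measurable_prodMk_left
  have hdens : M.P.map (M.data n) = (M.ν n).withDensity (M.p n) := M.density_p n
  calc ∫⁻ ω, M.R n θ (M.data n ω) ∂M.P = ∫⁻ x, M.R n θ x ∂(M.P.map (M.data n)) :=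
        (lintegral_map hR (M.measurable_data n)).symm
    _ = ∫⁻ x, M.p n x * M.R n θ x ∂M.ν n := by
        rw [hdens, lintegral_withDensity_eq_lintegral_mul _ (M.measurable_p n) hR]; rfl
    _ ≤ ∫⁻ x, M.f n θ x ∂M.ν n := lintegral_mono fun x => ENNReal.mul_div_le
    _ = (M.F θ).map (fun x (k : Fin n) => x k) univ := by
        rw [M.density_f, withDensity_apply _ MeasurableSet.univ, Measure.restrict_univ]
    _ ≤ 1 := by
        rw [Measure.map_apply (by fun_prop) MeasurableSet.univ]; exact prob_le_one

theorem lintegral_mass_le (hS : M.PosteriorConditions 𝒢) (n : ℕ) (A : Set (∀ j, T j)) :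
    ∫⁻ ω, M.mass n A (M.data n ω) ∂M.P ≤ M.prior A := by
  have := M.isProb_P
  have := M.isProb_prior
  have hswap := lintegral_lintegral_swap (μ := M.prior.restrict A) (ν := M.P)
    (f := fun θ ω => M.R n θ (M.data n ω)) (measurable_R_data hS n).aemeasurable
  calc ∫⁻ ω, M.mass n A (M.data n ω) ∂M.P
      = ∫⁻ θ in A, ∫⁻ ω, M.R n θ (M.data n ω) ∂M.P ∂M.prior := hswap.symm
    _ ≤ ∫⁻ _ in A, 1 ∂M.prior := lintegral_mono fun θ => lintegral_R_le_one hS n θ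
    _ = M.prior A := by simp

theorem ae_mass_univ_ne_top (hS : M.PosteriorConditions 𝒢) :
    ∀ᵐ ω ∂M.P, ∀ n, M.mass n univ (M.data n ω) ≠ ∞ := by
  have := M.isProb_prior
  refine ae_all_iff.2 fun n => ?_
  have hfin : ∫⁻ ω, M.mass n univ (M.data n ω) ∂M.P ≠ ∞ :=
    ((lintegral_mass_le hS n univ).trans_lt (measure_lt_top _ _)).ne
  filter_upwards [ae_lt_top ((measurable_mass hS n univ).comp (M.measurable_data n)) hfin]
    with ω h using h.ne

/-- The lower bound for the integrated likelihood ratio. By the equipartition property and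
Fubini's theorem, for almost all data the likelihood ratio is eventually at least `e^{-bn}` at
almost every `θ ∈ A` with `h θ < b`; from some sample size on this holds simultaneously on a set
of parameters of positive prior probability. -/
theorem ae_exists_le_mass (hS : M.PosteriorConditions 𝒢) {A : Set (∀ j, T j)}
    (hA : MeasurableSet A) {b : ℝ} (hb : M.hSet A < ENNReal.ofReal b) :
    ∀ᵐ ω ∂M.P, ∃ c : ℝ≥0∞, c ≠ 0 ∧ c ≠ ∞ ∧ ∀ᶠ n : ℕ in atTop,
      ENNReal.ofReal (Real.exp (-(n * b))) * c ≤ M.mass n A (M.data n ω) := by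
  have := M.isProb_P
  have := M.isProb_prior
  have hb0 : 0 < b := ENNReal.ofReal_pos.1 (bot_le.trans_lt hb)
  set S : Set (∀ j, T j) := A ∩ {θ | M.h θ < ENNReal.ofReal b} with hSdef
  have hSm : MeasurableSet S := hA.inter (hS.measurable_h measurableSet_Iio)
  have hSpos : M.prior S ≠ 0 := by
    intro h0
    refine hb.not_ge (le_essInf_of_ae_le _ ?_)
    rw [EventuallyLE, ae_restrict_iff' hA]
    filter_upwards [measure_eq_zero_iff_ae_notMem.1 h0] with θ hθ hθA
    exact not_lt.1 fun hlt => hθ ⟨hθA, hlt⟩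
  let D : (∀ j, T j) → Ω → ℕ → Prop := fun θ ω N =>
    ∀ n ≥ N, ENNReal.ofReal (Real.exp (-(n * b))) ≤ M.R n θ (M.data n ω)
  have hDm : ∀ N, MeasurableSet {z : (∀ j, T j) × Ω | D z.1 z.2 N} := fun N => by
    simp only [D, ofPred_forall]
    exact MeasurableSet.iInter fun n => MeasurableSet.iInter fun _ =>
      measurableSet_le measurable_const (measurable_R_data hS n)
  have hDSm : MeasurableSet {z : (∀ j, T j) × Ω | z.1 ∈ S → ∃ N, D z.1 z.2 N} := by
    have : {z : (∀ j, T j) × Ω | z.1 ∈ S → ∃ N, D z.1 z.2 N}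
        = (Prod.fst ⁻¹' S)ᶜ ∪ ⋃ N, {z | D z.1 z.2 N} := by
      ext z
      simp only [mem_ofPred_eq, mem_union, mem_compl_iff, mem_preimage, mem_iUnion]
      tauto
    rw [this]
    exact (measurable_fst hSm).compl.union (MeasurableSet.iUnion hDm)
  have hae : ∀ᵐ ω ∂M.P, ∀ᵐ θ ∂M.prior, θ ∈ S → ∃ N, D θ ω N := by
    rw [← Measure.ae_ae_comm hDSm]
    refine ae_of_all _ fun θ => ?_
    by_cases hθ : θ ∈ S
    · filter_upwards [hS.aep θ] with ω hω _
      have hlt : ((-b : ℝ) : EReal) < -(M.h θ : EReal) := by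
        have h1 : (M.h θ : EReal) < (b : EReal) := by
          have := EReal.coe_ennreal_lt_coe_ennreal_iff.2 hθ.2
          rwa [EReal.coe_ennreal_ofReal, max_eq_left hb0.le] at this
        rw [EReal.coe_neg]
        exact EReal.neg_lt_neg_iff.2 h1
      obtain ⟨N, hN⟩ := eventually_atTop.1
        ((hω.eventually (lt_mem_nhds hlt)).and (eventually_gt_atTop 0))
      refine ⟨N, fun n hn => ?_⟩
      have := (coe_lt_log_div_iff (hN n hn).2 _ _).1 (hN n hn).1
      rw [mul_neg] at this
      exact this.le
    · exact ae_of_all _ fun ω h => absurd h hθ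
  filter_upwards [hae] with ω hω
  obtain ⟨N, hN⟩ : ∃ N, M.prior (S ∩ {θ | D θ ω N}) ≠ 0 := by
    by_contra! hcon
    refine hSpos (measure_eq_zero_iff_ae_notMem.2 ?_)
    filter_upwards [hω, measure_eq_zero_iff_ae_notMem.1 (measure_iUnion_null hcon)]
      with θ h1 h2 hθ
    obtain ⟨N, hN⟩ := h1 hθ
    exact h2 (mem_iUnion.2 ⟨N, hθ, hN⟩)
  refine ⟨_, hN, measure_ne_top _ _, eventually_atTop.2 ⟨N, fun n hn => ?_⟩⟩
  have hsub : S ∩ {θ | D θ ω N} ⊆ A := fun θ hθ => hθ.1.1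
  have hm : MeasurableSet (S ∩ {θ | D θ ω N}) :=
    hSm.inter (measurable_prodMk_right (hDm N))
  calc ENNReal.ofReal (Real.exp (-(n * b))) * M.prior (S ∩ {θ | D θ ω N})
      = ∫⁻ _ in S ∩ {θ | D θ ω N}, ENNReal.ofReal (Real.exp (-(n * b))) ∂M.prior := by simp
    _ ≤ M.mass n (S ∩ {θ | D θ ω N}) (M.data n ω) :=
        setLIntegral_mono' hm fun θ hθ => hθ.2 n hn
    _ ≤ M.mass n A (M.data n ω) := M.mass_mono n hsub _

/-- Off the sieve the integrated likelihood ratio decays at every rate below the one of the prior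
mass, by Markov's inequality and the Borel–Cantelli argument. -/
theorem ae_tendsto_mass_compl_sieve (hS : M.PosteriorConditions 𝒢) {α ς r : ℝ} (hr : r < ς)
    (hG : ∀ n : ℕ, 1 - ENNReal.ofReal (α * Real.exp (-ς * n)) ≤ M.prior (𝒢 n)) :
    ∀ᵐ ω ∂M.P, Tendsto (fun n : ℕ =>
      ENNReal.ofReal (Real.exp (n * r)) * M.mass n (𝒢 n)ᶜ (M.data n ω)) atTop (𝓝 0) := by
  have := M.isProb_prior
  have hm : ∀ n : ℕ, Measurable fun ω =>
      ENNReal.ofReal (Real.exp (n * r)) * M.mass n (𝒢 n)ᶜ (M.data n ω) := fun n =>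
    ((measurable_mass hS n _).comp (M.measurable_data n)).const_mul _
  have hcompl : ∀ n, M.prior (𝒢 n)ᶜ ≤ ENNReal.ofReal (α * Real.exp (-ς * n)) := fun n => by
    rw [prob_compl_eq_one_sub (hS.measurable_sieve n)]
    exact tsub_le_iff_tsub_le.1 (hG n)
  have hterm : ∀ n : ℕ, ∫⁻ ω, ENNReal.ofReal (Real.exp (n * r)) *
      M.mass n (𝒢 n)ᶜ (M.data n ω) ∂M.P ≤ ENNReal.ofReal (α * Real.exp (r - ς) ^ n) := fun n => by
    rw [lintegral_const_mul' _ _ ENNReal.ofReal_ne_top]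
    calc _ ≤ ENNReal.ofReal (Real.exp (n * r)) * ENNReal.ofReal (α * Real.exp (-ς * n)) := by
          gcongr
          exact (lintegral_mass_le hS n _).trans (hcompl n)
      _ = _ := by
          rw [← ENNReal.ofReal_mul (Real.exp_pos _).le, mul_left_comm, ← Real.exp_add,
            ← Real.exp_nat_mul]
          ring_nf
  have hsum : ∫⁻ ω, ∑' n : ℕ, ENNReal.ofReal (Real.exp (n * r)) *
      M.mass n (𝒢 n)ᶜ (M.data n ω) ∂M.P ≠ ∞ := by
    rw [lintegral_tsum fun n => (hm n).aemeasurable]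
    refine ne_top_of_le_ne_top ?_ (ENNReal.tsum_le_tsum hterm)
    have hs : Summable fun n : ℕ => α * Real.exp (r - ς) ^ n :=
      (summable_geometric_of_lt_one (Real.exp_pos _).le
        (Real.exp_lt_one_iff.2 (by linarith))).mul_left _
    exact hs.tsum_ofReal_ne_top
  filter_upwards [ae_lt_top (Measurable.tsum hm) hsum] with ω hω
  exact ENNReal.tendsto_atTop_zero_of_tsum_ne_top hω.ne

/-- On the sieve the integrated likelihood ratio over `A` decays at every rate below the essential
infimum of `h` over `A`. For a fixed sieve set this is the uniform equipartition property; the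
condition on `τ` lets the sieve set grow with the sample size. -/
theorem ae_mass_sieve_inter_le (hS : M.PosteriorConditions 𝒢) {A : Set (∀ j, T j)}
    (hA : MeasurableSet A) (hpos : 0 < M.prior A) (hfin : M.hSet A < ∞) {s r : ℝ} (hrs : r < s)
    (hs0 : 0 ≤ s) (hs : ∀ᵐ θ ∂M.prior, θ ∈ A → ENNReal.ofReal s ≤ M.h θ) :
    ∀ᵐ ω ∂M.P, ∀ᶠ n : ℕ in atTop,
      M.mass n (𝒢 n ∩ A) (M.data n ω) ≤ ENNReal.ofReal (Real.exp (-(n * r))) := by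
  have := M.isProb_prior
  set δ := (s - r) / 2 with hδ
  have hδ0 : 0 < δ := by simp only [hδ]; linarith
  filter_upwards [ae_all_iff.2 hS.uniform_aep, ae_all_iff.2 hS.uniform_aep_infinite,
    hS.eventually_tau A hA hpos hfin δ hδ0] with ω h1 h2 h3
  have hlim : ∀ n, limsup (fun l => M.logMass l (𝒢 n ∩ A) ω) atTop ≤ ((-s + δ : ℝ) : EReal) := by
    intro n
    refine limsup_le_of_le (h := ?_)
    filter_upwards [h1 n δ hδ0, h2 n (-s + δ), eventually_gt_atTop 0] with l hl1 hl2 hl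
    rw [logMass, log_div_le_coe_iff hl]
    have hae : ∀ᵐ θ ∂M.prior.restrict (𝒢 n ∩ A),
        M.R l θ (M.data l ω) ≤ ENNReal.ofReal (Real.exp (l * (-s + δ))) := by
      rw [ae_restrict_iff' ((hS.measurable_sieve n).inter hA)]
      filter_upwards [(ae_restrict_iff' (hS.measurable_sieve n)).1 hl2, hs] with θ ht2 ht3 hθ
      rw [← log_div_le_coe_iff hl]
      by_cases hθi : M.h θ = ∞
      · exact ht2 hθ.1 hθi
      · refine ((hl1 θ hθ.1 hθi).2).trans ?_
        have h4 : (s : EReal) ≤ (M.h θ : EReal) := by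
          have := EReal.coe_ennreal_le_coe_ennreal_iff.2 (ht3 hθ.2)
          rwa [EReal.coe_ennreal_ofReal, max_eq_left hs0] at this
        rw [EReal.coe_add, EReal.coe_neg]
        exact add_le_add_left (EReal.neg_le_neg_iff.2 h4) _
    calc M.mass l (𝒢 n ∩ A) (M.data l ω)
        ≤ ∫⁻ _ in 𝒢 n ∩ A, ENNReal.ofReal (Real.exp (l * (-s + δ))) ∂M.prior :=
          lintegral_mono_ae hae
      _ = ENNReal.ofReal (Real.exp (l * (-s + δ))) * M.prior (𝒢 n ∩ A) := by simp
      _ ≤ _ := mul_le_of_le_one_right' prob_le_one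
  filter_upwards [h3, eventually_gt_atTop 0] with n hn hn0
  have h5 : M.logMass n (𝒢 n ∩ A) ω ≤ ((-r : ℝ) : EReal) := by
    refine (hn n le_rfl).trans ((add_le_add_right (hlim n) _).trans ?_)
    rw [← EReal.coe_add, EReal.coe_le_coe_iff]
    simp only [hδ]; linarith
  rw [logMass, log_div_le_coe_iff hn0, mul_neg] at h5
  exact h5

/-! ### Posterior concentration on the true configuration -/

theorem hSet_anti (M : TestingProblem Ω Ξ T m) {A B : Set (∀ j, T j)} (h : A ⊆ B) :
    M.hSet B ≤ M.hSet A :=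
  essInf_antitone_measure (Measure.restrict_mono h le_rfl).absolutelyContinuous

/-- Off the cell of the true configuration, `h` exceeds its essential infimum by a margin, as only
finitely many configurations compete. -/
theorem exists_margin (hdt : M.IsTrueConfig dt) (hfin : M.hSet univ < ∞) :
    ∃ c : ℝ, 0 < c ∧ ∀ᵐ θ ∂M.prior, θ ∈ (M.cell dt)ᶜ →
      ENNReal.ofReal ((M.hSet univ).toReal + c) ≤ M.h θ := by
  have hc : ∀ d : Decision m, ∀ᶠ c : ℝ in 𝓝[>] 0, d ≠ dt → ENNReal.ofReal c ≤ M.J (M.cell d) := by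
    intro d
    by_cases hd : d = dt
    · simp [hd]
    · have ht : Tendsto ENNReal.ofReal (𝓝[>] 0) (𝓝 0) := by
        have := (ENNReal.continuous_ofReal.tendsto 0).mono_left (nhdsWithin_le_nhds (s := Ioi 0))
        rwa [ENNReal.ofReal_zero] at this
      filter_upwards [ht.eventually (gt_mem_nhds (hdt.2 d hd))] with c hc _ using hc.le
  obtain ⟨c, hcJ, hc0⟩ := ((eventually_all.2 hc).and self_mem_nhdsWithin).exists
  refine ⟨c, hc0, ?_⟩
  have hJ : ∀ d, ∀ᵐ θ ∂M.prior, θ ∈ M.cell d → M.J (M.cell d) ≤ M.h θ - M.hSet univ := fun d =>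
    (ae_restrict_iff' (M.measurableSet_cell d)).1 ae_essInf_le
  filter_upwards [ae_all_iff.2 hJ] with θ hθ hmem
  classical
  let d : Decision m := fun i => decide (θ (M.test i) ∈ M.H1 i)
  have hd : θ ∈ M.cell d := mem_iInter.2 fun i => by simp [hyp, d]
  have hne : d ≠ dt := fun h => hmem (h ▸ hd)
  have h1 : ENNReal.ofReal c ≤ M.h θ - M.hSet univ := (hcJ d hne).trans (hθ d hd)
  have hc0' : (0 : ℝ) < c := hc0
  rw [ENNReal.ofReal_add ENNReal.toReal_nonneg hc0'.le, ENNReal.ofReal_toReal hfin.ne]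
  have h2 : 0 < M.h θ - M.hSet univ := (ENNReal.ofReal_pos.2 hc0').trans_le h1
  calc M.hSet univ + ENNReal.ofReal c ≤ M.hSet univ + (M.h θ - M.hSet univ) := by gcongr
    _ = M.h θ := add_tsub_cancel_of_le (tsub_pos_iff_lt.1 h2).le

/-- Almost surely, the posterior probability of all configurations but the true one vanishes
asymptotically. A true null hypothesis `i` is needed because the condition on `τ` speaks only of
sets on which the essential infimum of `h` is finite, and the complement of the true cell is such
a set because it contains the alternative of `i`. -/
theorem ae_tendsto_posterior_compl_cell (hS : M.PosteriorConditions 𝒢) (hdt : M.IsTrueConfig dt)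
    {i : Fin m} (hi : dt i = false) (hipos : 0 < M.prior (M.alt i))
    (hifin : M.hSet (M.alt i) < ∞) :
    ∀ᵐ ω ∂M.P, Tendsto (fun n => M.posterior n (M.cell dt)ᶜ (M.data n ω)) atTop (𝓝 0) := by
  set A := (M.cell dt)ᶜ with hAdef
  have hAm : MeasurableSet A := (M.measurableSet_cell dt).compl
  have hsub : M.alt i ⊆ A := fun θ hθ hmem => by
    have := mem_iInter.1 hmem i
    simp only [hyp, mem_ofPred_eq, hi, Bool.false_eq_true, iff_false] at this
    exact this hθ
  have hHfin : M.hSet univ < ∞ := (M.hSet_anti (subset_univ _)).trans_lt hifin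
  obtain ⟨c, hc0, hc⟩ := exists_margin hdt hHfin
  obtain ⟨α, ς, -, hς, hG⟩ := hS.prior_sieve
  set H := (M.hSet univ).toReal with hH
  have hH0 : 0 ≤ H := ENNReal.toReal_nonneg
  have hHς : H < ς := by
    have h1 : M.hSet univ < ENNReal.ofReal ς := by
      refine lt_of_le_of_lt ?_ hς
      rw [two_mul]; exact le_self_add
    exact (ENNReal.lt_ofReal_iff_toReal_lt hHfin.ne).1 h1
  obtain ⟨r, hHr, hr⟩ := exists_between (lt_min hHς (lt_add_of_pos_right H hc0))
  obtain ⟨b, hHb, hbr⟩ := exists_between hHr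
  have hb : M.hSet univ < ENNReal.ofReal b := (ENNReal.lt_ofReal_iff_toReal_lt hHfin.ne).2 hHb
  filter_upwards [ae_exists_le_mass hS MeasurableSet.univ hb,
    ae_tendsto_mass_compl_sieve hS (hr.trans_le (min_le_left _ _)) hG,
    ae_mass_sieve_inter_le hS hAm (hipos.trans_le (measure_mono hsub))
      ((M.hSet_anti hsub).trans_lt hifin) (hr.trans_le (min_le_right _ _)) (by positivity) hc]
    with ω ⟨k, hk0, hkt, hk⟩ h2 h3
  have hlim : Tendsto (fun n : ℕ => ENNReal.ofReal (Real.exp (b - r) ^ n) * (2 * k⁻¹)) atTop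
      (𝓝 0) := by
    have h4 : Tendsto (fun n : ℕ => ENNReal.ofReal (Real.exp (b - r) ^ n)) atTop (𝓝 0) := by
      have := ENNReal.tendsto_ofReal (tendsto_pow_atTop_nhds_zero_of_lt_one
        (Real.exp_pos (b - r)).le (Real.exp_lt_one_iff.2 (by linarith)))
      rwa [ENNReal.ofReal_zero] at this
    have := ENNReal.Tendsto.mul_const (b := 2 * k⁻¹) h4
      (Or.inr (ENNReal.mul_ne_top (by simp) (ENNReal.inv_ne_top.2 hk0)))
    rwa [zero_mul] at this
  have hratio : Tendsto (fun n => M.mass n A (M.data n ω) / M.mass n univ (M.data n ω)) atTop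
      (𝓝 0) := by
    refine tendsto_of_tendsto_of_tendsto_of_le_of_le' tendsto_const_nhds hlim
      (Eventually.of_forall fun _ => bot_le) ?_
    filter_upwards [hk, h3, h2.eventually (ge_mem_nhds zero_lt_one)] with n hn1 hn3 hn2
    have hexp : ∀ x : ℝ, ENNReal.ofReal (Real.exp x) ≠ 0 := fun x =>
      (ENNReal.ofReal_pos.2 (Real.exp_pos x)).ne'
    have hsieve : M.mass n (𝒢 n)ᶜ (M.data n ω) ≤ ENNReal.ofReal (Real.exp (-(n * r))) := by
      rw [mul_comm, ← ENNReal.le_div_iff_mul_le (Or.inl (hexp _)) (Or.inl ENNReal.ofReal_ne_top),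
        one_div, ← ENNReal.ofReal_inv_of_pos (Real.exp_pos _), ← Real.exp_neg] at hn2
      exact hn2
    have hA2 : M.mass n A (M.data n ω) ≤ 2 * ENNReal.ofReal (Real.exp (-(n * r))) := by
      have hcov : A ⊆ (𝒢 n ∩ A) ∪ (𝒢 n)ᶜ := fun θ hθ => by
        by_cases h : θ ∈ 𝒢 n
        · exact Or.inl ⟨h, hθ⟩
        · exact Or.inr h
      refine (M.mass_mono n hcov _).trans ((lintegral_union_le _ _ _).trans ?_)
      rw [two_mul]
      exact add_le_add hn3 hsieve
    refine (ENNReal.div_le_div hA2 hn1).trans (le_of_eq ?_)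
    rw [div_eq_mul_inv, ENNReal.mul_inv (Or.inl (hexp _)) (Or.inl ENNReal.ofReal_ne_top),
      ← ENNReal.ofReal_inv_of_pos (Real.exp_pos _), ← Real.exp_neg]
    have : Real.exp (b - r) ^ n = Real.exp (-(n * r)) * Real.exp (- -(n * b)) := by
      rw [← Real.exp_nat_mul, ← Real.exp_add]; ring_nf
    rw [this, ENNReal.ofReal_mul (Real.exp_pos _).le]
    ring
  have := (ENNReal.tendsto_toReal ENNReal.zero_ne_top).comp hratio
  rwa [ENNReal.toReal_zero] at this

/-! ### The criterion and the posterior false discovery rate -/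

/-- The posterior expected number `∑ d_i w_{in}(d)` of true discoveries. -/
noncomputable def gain (M : TestingProblem Ω Ξ T m) (G : Fin m → Finset (Fin m)) (n : ℕ)
    (x : Fin n → Ξ) (d : Decision m) : ℝ :=
  ∑ i, digit (d i) * M.w G n x i d

theorem criterion_eq (M : TestingProblem Ω Ξ T m) (G : Fin m → Finset (Fin m)) (β : ℝ) (n : ℕ)
    (x : Fin n → Ξ) (d : Decision m) :
    M.criterion G β n x d = M.gain G n x d - β * rejections d := by
  simp only [criterion, gain, rejections, mul_sub, Finset.sum_sub_distrib, Finset.sum_mul,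
    mul_comm β]

theorem mFDR_eq (M : TestingProblem Ω Ξ T m) (G : Fin m → Finset (Fin m)) (n : ℕ)
    (δ : (Fin n → Ξ) → Decision m) (x : Fin n → Ξ) :
    M.mFDR G n δ x = (rejections (δ x) - M.gain G n x (δ x)) / max (rejections (δ x)) 1 := by
  simp only [mFDR, gain, rejections, mul_sub, Finset.sum_sub_distrib, mul_one]

theorem gain_nonneg (M : TestingProblem Ω Ξ T m) (G : Fin m → Finset (Fin m)) (n : ℕ)
    (x : Fin n → Ξ) (d : Decision m) : 0 ≤ M.gain G n x d :=
  Finset.sum_nonneg fun _ _ => mul_nonneg (digit_nonneg _) (M.posterior_nonneg _ _ _)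

theorem gain_le_rejections (M : TestingProblem Ω Ξ T m) (G : Fin m → Finset (Fin m)) (n : ℕ)
    (x : Fin n → Ξ) (d : Decision m) : M.gain G n x d ≤ rejections d :=
  Finset.sum_le_sum fun _ _ =>
    mul_le_of_le_one_right (digit_nonneg _) (M.posterior_le_one _ _ _)

@[simp]
theorem gain_false (M : TestingProblem Ω Ξ T m) (G : Fin m → Finset (Fin m)) (n : ℕ)
    (x : Fin n → Ξ) : M.gain G n x (fun _ => false) = 0 := by
  simp [gain, digit]

theorem mFDR_nonneg (M : TestingProblem Ω Ξ T m) (G : Fin m → Finset (Fin m)) (n : ℕ)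
    (δ : (Fin n → Ξ) → Decision m) (x : Fin n → Ξ) : 0 ≤ M.mFDR G n δ x := by
  rw [mFDR_eq]
  exact div_nonneg (sub_nonneg.2 (M.gain_le_rejections G n x _))
    (zero_le_one.trans (le_max_right _ _))

theorem mFDR_le_one (M : TestingProblem Ω Ξ T m) (G : Fin m → Finset (Fin m)) (n : ℕ)
    (δ : (Fin n → Ξ) → Decision m) (x : Fin n → Ξ) : M.mFDR G n δ x ≤ 1 := by
  rw [mFDR_eq]
  exact div_le_one_of_le₀ ((sub_le_self _ (M.gain_nonneg G n x _)).trans (le_max_left _ _))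
    (zero_le_one.trans (le_max_right _ _))

theorem mFDR_of_ne {n : ℕ} {δ : (Fin n → Ξ) → Decision m} {x : Fin n → Ξ}
    (h : δ x ≠ fun _ => false) :
    M.mFDR G n δ x = 1 - M.gain G n x (δ x) / rejections (δ x) := by
  have := one_le_rejections h
  rw [mFDR_eq, max_eq_left this, sub_div, div_self (by linarith)]

theorem measurable_mFDR (hS : M.PosteriorConditions 𝒢) (G : Fin m → Finset (Fin m)) {n : ℕ}
    {δ : (Fin n → Ξ) → Decision m} (hδ : Measurable δ) : Measurable (M.mFDR G n δ) := by
  let Φ : Decision m × (Fin n → Ξ) → ℝ := fun z =>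
    (∑ i, digit (z.1 i) * (1 - M.w G n z.2 i z.1)) / max (rejections z.1) 1
  have hΦ : Measurable Φ := measurable_from_prod_countable_right fun d => by
    have hw : ∀ i, Measurable fun y => M.w G n y i d := fun i => measurable_posterior hS n _
    change Measurable fun y =>
      (∑ i, digit (d i) * (1 - M.w G n y i d)) / max (rejections d) 1
    exact (Finset.measurable_fun_sum _ fun i _ => ((hw i).const_sub 1).const_mul _).div_const _
  exact hΦ.comp (hδ.prodMk measurable_id)

theorem integrable_mFDR (hS : M.PosteriorConditions 𝒢) (G : Fin m → Finset (Fin m)) {n : ℕ}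
    {δ : (Fin n → Ξ) → Decision m} (hδ : Measurable δ) :
    Integrable (fun ω => M.mFDR G n δ (M.data n ω)) M.P := by
  have := M.isProb_P
  refine Integrable.of_bound
    ((measurable_mFDR hS G hδ).comp (M.measurable_data n)).aestronglyMeasurable 1
    (ae_of_all _ fun ω => ?_)
  rw [Real.norm_of_nonneg (M.mFDR_nonneg G n δ _)]
  exact M.mFDR_le_one G n δ _

theorem measurableSet_ne_false {n : ℕ} {δ : (Fin n → Ξ) → Decision m} (hδ : Measurable δ) :
    MeasurableSet {ω | δ (M.data n ω) ≠ fun _ => false} :=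
  (hδ.comp (M.measurable_data n)) (measurableSet_singleton (fun _ : Fin m => false)).compl

/-! ### Monotonicity in the penalizing constant -/

/-- A larger penalty never yields more rejections, whatever the ties: add the two optimality
inequalities. -/
theorem rejections_anti {n : ℕ} {x : Fin n → Ξ} {β₁ β₂ : ℝ} (hβ : β₁ < β₂) {d₁ d₂ : Decision m}
    (h₁ : ∀ d, M.criterion G β₁ n x d ≤ M.criterion G β₁ n x d₁)
    (h₂ : ∀ d, M.criterion G β₂ n x d ≤ M.criterion G β₂ n x d₂) :
    rejections d₂ ≤ rejections d₁ := by
  have h3 := h₁ d₂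
  have h4 := h₂ d₁
  rw [criterion_eq, criterion_eq] at h3 h4
  by_contra! hlt
  nlinarith [mul_pos (sub_pos.2 hβ) (sub_pos.2 hlt)]

/-- The conditioning events shrink as `β` grows, but on the part that is lost the smaller penalty
has posterior false discovery rate at least `1 - β₂`, and on the part that is kept the larger one
has at most that; so the conditional expectation still decreases. -/
theorem mpBFDR_anti (hS : M.PosteriorConditions 𝒢) (hdhat : M.IsNonMarginal G dhat) (n : ℕ)
    {β₁ β₂ : ℝ} (h₁ : β₁ ∈ Ico (0 : ℝ) 1) (h₂ : β₂ ∈ Ico (0 : ℝ) 1) (hβ : β₁ < β₂) :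
    M.mpBFDR G n (dhat n β₂) ≤ M.mpBFDR G n (dhat n β₁) := by
  have := M.isProb_P
  obtain ⟨hm₁, hopt₁⟩ := hdhat n β₁ h₁
  obtain ⟨hm₂, hopt₂⟩ := hdhat n β₂ h₂
  have hrej : ∀ x, rejections (dhat n β₂ x) ≤ rejections (dhat n β₁ x) := fun x =>
    rejections_anti hβ (hopt₁ x) (hopt₂ x)
  have hne : ∀ x, dhat n β₂ x ≠ (fun _ => false) → dhat n β₁ x ≠ fun _ => false := fun x h h' => by
    have h3 := one_le_rejections h
    have h4 := hrej x
    rw [h', rejections_false] at h4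
    linarith
  have hratio : ∀ x, dhat n β₂ x ≠ (fun _ => false) →
      β₂ ≤ M.gain G n x (dhat n β₂ x) / rejections (dhat n β₂ x) := fun x h => by
    have h3 := hopt₂ x fun _ => false
    rw [criterion_eq, criterion_eq, gain_false, rejections_false] at h3
    rw [le_div_iff₀ (zero_lt_one.trans_le (one_le_rejections h))]
    linarith
  refine integral_cond_le_integral_cond (a := 1 - β₂) (measurableSet_ne_false hm₁)
    (measurableSet_ne_false hm₂) (fun ω hω => hne _ hω) (integrable_mFDR hS G hm₁)
    (integrable_mFDR hS G hm₂) (fun ω => M.mFDR_nonneg G n _ _) ?_ ?_ ?_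
  · intro ω hω
    set x := M.data n ω
    change dhat n β₂ x ≠ fun _ => false at hω
    rw [mFDR_of_ne hω, mFDR_of_ne (hne x hω)]
    have hr₂ := zero_lt_one.trans_le (one_le_rejections hω)
    have hr₁ := zero_lt_one.trans_le (one_le_rejections (hne x hω))
    have h3 := hopt₂ x (dhat n β₁ x)
    rw [criterion_eq, criterion_eq] at h3
    have h4 := hratio x hω
    refine sub_le_sub_left ?_ 1
    -- Either the mean gain at the smaller penalty is below `β₂`, and the claim is `hratio`, or
    -- dropping rejections at the price `β₂` each cannot lower the mean gain.
    rcases le_total (M.gain G n x (dhat n β₁ x) / rejections (dhat n β₁ x)) β₂ with h5 | h5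
    · exact h5.trans h4
    · rw [div_le_div_iff₀ hr₁ hr₂]
      rw [le_div_iff₀ hr₁] at h5
      nlinarith [mul_nonneg (sub_nonneg.2 h5) (sub_nonneg.2 (hrej x)),
        mul_nonneg hr₁.le (sub_nonneg.2 h3)]
  · intro ω hω
    change dhat n β₂ (M.data n ω) ≠ fun _ => false at hω
    rw [mFDR_of_ne hω]
    linarith [hratio _ hω]
  · rintro ω ⟨hω₁, hω₂⟩
    set x := M.data n ω
    change dhat n β₁ x ≠ fun _ => false at hω₁
    have hω₂ : dhat n β₂ x = fun _ => false := not_not.1 hω₂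
    have h3 := hopt₂ x (dhat n β₁ x)
    rw [hω₂, criterion_eq, criterion_eq, gain_false, rejections_false] at h3
    rw [mFDR_of_ne hω₁]
    refine sub_le_sub_left ?_ 1
    rw [div_le_iff₀ (zero_lt_one.trans_le (one_le_rejections hω₁))]
    linarith

/-! ### Unpenalized decisions under a concentrated posterior -/

theorem one_sub_le_w {n : ℕ} {x : Fin n → Ξ} (h0 : M.mass n univ x ≠ 0)
    (ht : M.mass n univ x ≠ ∞) {d : Decision m} {i : Fin m} (hi : dt i = true)
    (hd : ∀ j ∈ (G i).erase i, d j = dt j) :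
    1 - M.posterior n (M.cell dt)ᶜ x ≤ M.w G n x i d := by
  have h1 := M.posterior_add_posterior_compl n (M.measurableSet_cell dt) x h0 ht
  have hsub : M.cell dt ⊆ M.alt i ∩ ⋂ j ∈ (G i).erase i, M.hyp d j := fun θ hθ => by
    have hθ' := mem_iInter.1 hθ
    refine ⟨(hθ' i).2 hi, mem_iInter₂.2 fun j hj => ?_⟩
    have := hθ' j
    simp only [hyp, mem_ofPred_eq, hd j hj] at this ⊢
    exact this
  have h2 := M.posterior_mono n hsub x
  rw [w]
  linarith

theorem w_le {n : ℕ} {x : Fin n → Ξ} {d : Decision m} {i : Fin m}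
    (h : ¬(dt i = true ∧ ∀ j ∈ (G i).erase i, d j = dt j)) :
    M.w G n x i d ≤ M.posterior n (M.cell dt)ᶜ x := by
  refine M.posterior_mono n (B := (M.cell dt)ᶜ)
    (fun θ hθ => mem_compl fun hmem => h ⟨?_, fun j hj => ?_⟩) x
  · exact ((mem_iInter.1 hmem) i).1 hθ.1
  · have h1 := (mem_iInter.1 hmem) j
    have h2 := mem_iInter₂.1 hθ.2 j hj
    simp only [hyp, mem_ofPred_eq] at h1 h2
    exact Bool.eq_iff_iff.2 (h2.symm.trans h1)

theorem le_gain_true {n : ℕ} {x : Fin n → Ξ} (h0 : M.mass n univ x ≠ 0)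
    (ht : M.mass n univ x ≠ ∞) :
    rejections dt - m * M.posterior n (M.cell dt)ᶜ x ≤ M.gain G n x dt := by
  have h1 : ∑ i, (digit (dt i) - M.posterior n (M.cell dt)ᶜ x) ≤ M.gain G n x dt := by
    refine Finset.sum_le_sum fun i _ => ?_
    cases hi : dt i
    · simpa [digit] using M.posterior_nonneg _ _ _
    · simpa [digit] using one_sub_le_w (d := dt) h0 ht hi fun _ _ => rfl
  simpa [rejections, Finset.sum_sub_distrib] using h1

theorem gain_le {n : ℕ} {x : Fin n → Ξ} (d : Decision m) :
    M.gain G n x d ≤ rejections dt + m * M.posterior n (M.cell dt)ᶜ x := by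
  have h1 : M.gain G n x d ≤ ∑ i, (digit (dt i) + M.posterior n (M.cell dt)ᶜ x) := by
    refine Finset.sum_le_sum fun i _ => ?_
    have hw0 : 0 ≤ M.w G n x i d := M.posterior_nonneg _ _ _
    have hq0 := M.posterior_nonneg n (M.cell dt)ᶜ x
    refine (mul_le_of_le_one_left hw0 (digit_le_one _)).trans ?_
    cases hi : dt i
    · simpa [digit] using w_le (M := M) (G := G) (x := x) (d := d) (i := i) (dt := dt)
        (by simp [hi])
    · have : M.w G n x i d ≤ 1 := M.posterior_le_one _ _ _
      simp only [digit, if_true]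
      linarith
  simpa [rejections, Finset.sum_add_distrib] using h1

/-- A decision that errs on the group of a false null hypothesis forgoes a whole discovery. -/
theorem gain_le_of_ne {n : ℕ} {x : Fin n → Ξ} {d : Decision m} {i j : Fin m} (hi : dt i = true)
    (hj : j ∈ G i) (hd : d j ≠ dt j) :
    M.gain G n x d ≤ rejections dt - 1 + m * M.posterior n (M.cell dt)ᶜ x := by
  have h1 : M.gain G n x d ≤
      ∑ k, (digit (dt k) - (if k = i then 1 else 0) + M.posterior n (M.cell dt)ᶜ x) := by
    refine Finset.sum_le_sum fun k _ => ?_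
    have hw0 : 0 ≤ M.w G n x k d := M.posterior_nonneg _ _ _
    have hw1 : M.w G n x k d ≤ 1 := M.posterior_le_one _ _ _
    have hq0 := M.posterior_nonneg n (M.cell dt)ᶜ x
    by_cases hk : k = i
    · subst hk
      simp only [hi, digit, if_true, sub_self, zero_add]
      change digit (d k) * _ ≤ _
      by_cases hjk : j = k
      · subst hjk
        have : d j = false := by simpa [hi] using hd
        simpa [this, digit] using hq0
      · exact (mul_le_of_le_one_left hw0 (digit_le_one _)).trans
          (w_le fun h => hd (h.2 j (Finset.mem_erase.2 ⟨hjk, hj⟩)))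
    · simp only [hk, if_false, sub_zero]
      refine (mul_le_of_le_one_left hw0 (digit_le_one _)).trans ?_
      cases hk' : dt k
      · simpa [digit] using w_le (M := M) (G := G) (x := x) (d := d) (i := k) (dt := dt)
          (by simp [hk'])
      · simp only [digit, if_true]
        linarith
  simpa [rejections, Finset.sum_add_distrib, Finset.sum_sub_distrib] using h1

/-- Without a penalty it is profitable to reject some hypothesis of the second block, all of
which are true: each has an alternative of positive posterior probability, and by disjointness of
the blocks the decisions there do not affect the gain in the first block. -/
theorem exists_gain_true_lt {m₁ : ℕ} (hG_self : ∀ i, i ∈ G i)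
    (hG_true : ∀ i : Fin m, m₁ ≤ (i : ℕ) → ∀ j ∈ G i, dt j = false)
    (hG_disj : ∀ i k : Fin m, (i : ℕ) < m₁ → m₁ ≤ (k : ℕ) → Disjoint (G i) (G k))
    {n : ℕ} {x : Fin n → Ξ} (ht : M.mass n univ x ≠ ∞) {k : Fin m} (hk : m₁ ≤ (k : ℕ))
    (hmass : M.mass n (M.alt k) x ≠ 0) :
    ∃ d, M.gain G n x dt < M.gain G n x d := by
  classical
  -- The configuration `e` near `k` may depend on the data: the given assumptions bound only the
  -- whole alternative of `k` away from zero.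
  obtain ⟨e, he⟩ : ∃ e : Decision m,
      M.mass n (M.alt k ∩ ⋂ j ∈ (G k).erase k, M.hyp e j) x ≠ 0 := by
    by_contra! hcon
    have hcov : M.alt k ⊆ ⋃ e : Decision m, M.alt k ∩ ⋂ j ∈ (G k).erase k, M.hyp e j :=
      fun θ hθ => mem_iUnion.2 ⟨fun i => decide (θ (M.test i) ∈ M.H1 i), hθ,
        mem_iInter₂.2 fun j _ => by simp [hyp]⟩
    refine hmass (le_antisymm ((M.mass_mono n hcov x).trans ?_) bot_le)
    refine (lintegral_iUnion_le _ _).trans (le_of_eq ?_)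
    exact ENNReal.tsum_eq_zero.2 hcon
  let d : Decision m := fun i => if (i : ℕ) < m₁ then dt i else if i = k then true else e i
  have hwk : 0 < M.w G n x k d := by
    have hset : (⋂ j ∈ (G k).erase k, M.hyp d j) = ⋂ j ∈ (G k).erase k, M.hyp e j := by
      refine iInter₂_congr fun j hj => ?_
      obtain ⟨hjk, hjG⟩ := Finset.mem_erase.1 hj
      have hjm : ¬(j : ℕ) < m₁ := fun hlt =>
        Finset.disjoint_left.1 (hG_disj j k hlt hk) (hG_self j) hjG
      have hdj : d j = e j := by simp [d, hjm, hjk]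
      simp only [hyp, hdj]
    rw [w, hset]
    exact M.posterior_pos n he ht
  have hterm : ∀ i, digit (dt i) * M.w G n x i dt ≤ digit (d i) * M.w G n x i d := by
    intro i
    by_cases hi : (i : ℕ) < m₁
    · have hset : (⋂ j ∈ (G i).erase i, M.hyp d j) = ⋂ j ∈ (G i).erase i, M.hyp dt j := by
        refine iInter₂_congr fun j hj => ?_
        have hjm : (j : ℕ) < m₁ := by
          by_contra! hge
          exact Finset.disjoint_left.1 (hG_disj i j hi hge) (Finset.mem_of_mem_erase hj)
            (hG_self j)
        have hdj : d j = dt j := by simp [d, hjm]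
        simp only [hyp, hdj]
      have hdi : d i = dt i := by simp [d, hi]
      simp only [w, hset, hdi, le_refl]
    · have hdi : dt i = false := hG_true i (not_lt.1 hi) i (hG_self i)
      have h0 : digit (dt i) = 0 := by simp [digit, hdi]
      rw [h0, zero_mul]
      exact mul_nonneg (digit_nonneg _) (M.posterior_nonneg _ _ _)
  refine ⟨d, Finset.sum_lt_sum (fun i _ => hterm i) ⟨k, Finset.mem_univ k, ?_⟩⟩
  have hdk : dt k = false := hG_true k hk k (hG_self k)
  have h0 : digit (dt k) = 0 := by simp [digit, hdk]
  have h1 : digit (d k) = 1 := by simp [digit, d, not_lt.2 hk]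
  rw [h0, h1, zero_mul, one_mul]
  exact hwk

/-- Once the posterior concentrates on `dt`, an unpenalized decision agrees with `dt` on the first
block and rejects between one and all of the hypotheses of the second block; its gain is close to
the number of false null hypotheses. -/
theorem mFDR_mem_of_concentrated (hdt0 : dt ≠ fun _ => false) {m₁ : ℕ} (hm₁ : m₁ < m)
    (hG_self : ∀ i, i ∈ G i) (hG_symm : ∀ i j, j ∈ G i → i ∈ G j)
    (hG_false : ∀ i : Fin m, (i : ℕ) < m₁ → ∃ j ∈ G i, dt j = true)
    (hG_true : ∀ i : Fin m, m₁ ≤ (i : ℕ) → ∀ j ∈ G i, dt j = false)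
    (hG_disj : ∀ i k : Fin m, (i : ℕ) < m₁ → m₁ ≤ (k : ℕ) → Disjoint (G i) (G k))
    {n : ℕ} {x : Fin n → Ξ} (ht : M.mass n univ x ≠ ∞) {k : Fin m} (hk : m₁ ≤ (k : ℕ))
    (hmass : M.mass n (M.alt k) x ≠ 0) (hq : m * M.posterior n (M.cell dt)ᶜ x < 1 / 2)
    {δ : (Fin n → Ξ) → Decision m}
    (hopt : ∀ d, M.criterion G 0 n x d ≤ M.criterion G 0 n x (δ x)) :
    δ x ≠ (fun _ => false) ∧
    1 / (rejections dt + 1) - m * M.posterior n (M.cell dt)ᶜ x ≤ M.mFDR G n δ x ∧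
    M.mFDR G n δ x ≤ ((m : ℝ) - m₁) / (rejections dt + ((m : ℝ) - m₁)) +
      m * M.posterior n (M.cell dt)ᶜ x := by
  have h0 : M.mass n univ x ≠ 0 := fun h =>
    hmass (le_antisymm (h ▸ M.mass_mono n (subset_univ _) x) bot_le)
  set q := M.posterior n (M.cell dt)ᶜ x with hqdef
  have hq0 : 0 ≤ m * q := mul_nonneg m.cast_nonneg (M.posterior_nonneg _ _ _)
  have hopt' : ∀ d, M.gain G n x d ≤ M.gain G n x (δ x) := fun d => by
    simpa [criterion_eq] using hopt d
  have hlow : rejections dt - m * q ≤ M.gain G n x (δ x) :=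
    (le_gain_true h0 ht).trans (hopt' dt)
  have hupp : M.gain G n x (δ x) ≤ rejections dt + m * q := gain_le _
  have hagree : ∀ i j, dt i = true → j ∈ G i → δ x j = dt j := fun i j hi hj => by
    by_contra hne
    have := gain_le_of_ne (M := M) (x := x) hi hj hne
    linarith
  have hfirst : ∀ i : Fin m, (i : ℕ) < m₁ → δ x i = dt i := fun i hi => by
    obtain ⟨j, hj, hjt⟩ := hG_false i hi
    exact hagree j i hjt (hG_symm i j hj)
  have hsecond : ∀ i : Fin m, m₁ ≤ (i : ℕ) → dt i = false := fun i hi =>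
    hG_true i hi i (hG_self i)
  obtain ⟨l, hl, hlt⟩ : ∃ l : Fin m, m₁ ≤ (l : ℕ) ∧ δ x l = true := by
    by_contra! hcon
    have heq : δ x = dt := funext fun i => by
      rcases lt_or_ge (i : ℕ) m₁ with hi | hi
      · exact hfirst i hi
      · rw [hsecond i hi]; simpa using hcon i hi
    obtain ⟨d, hd⟩ := exists_gain_true_lt hG_self hG_true hG_disj ht hk hmass
    exact (heq ▸ hopt' d).not_gt hd
  have hdiff : ∀ i, 0 ≤ digit (δ x i) - digit (dt i) ∧
      digit (δ x i) - digit (dt i) ≤ if m₁ ≤ (i : ℕ) then (1 : ℝ) else 0 := fun i => by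
    rcases lt_or_ge (i : ℕ) m₁ with hi | hi
    · simp [hfirst i hi, not_le.2 hi]
    · have hd0 : digit (dt i) = 0 := by simp [digit, hsecond i hi]
      rw [hd0, sub_zero, if_pos hi]
      exact ⟨digit_nonneg _, digit_le_one _⟩
  have hsum : rejections (δ x) - rejections dt = ∑ i, (digit (δ x i) - digit (dt i)) := by
    rw [Finset.sum_sub_distrib]; rfl
  have hN1 : rejections dt + 1 ≤ rejections (δ x) := by
    have h1 := Finset.single_le_sum (f := fun i => digit (δ x i) - digit (dt i))
      (fun i _ => (hdiff i).1) (Finset.mem_univ l)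
    have h2 : digit (δ x l) - digit (dt l) = 1 := by simp [digit, hlt, hsecond l hl]
    rw [← hsum] at h1
    linarith
  have hN0 : 0 < rejections (δ x) := by linarith [rejections_nonneg dt]
  have hN2 : rejections (δ x) ≤ rejections dt + ((m : ℝ) - m₁) := by
    have h1 := Finset.sum_le_sum fun i (_ : i ∈ Finset.univ) => (hdiff i).2
    rw [← hsum, sum_fin_indicator_le hm₁.le] at h1
    linarith
  have hne : δ x ≠ fun _ => false := fun h => by simp [h] at hlt
  have hD : 1 ≤ rejections dt := one_le_rejections hdt0
  refine ⟨hne, ?_, ?_⟩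
  · rw [mFDR_of_ne hne]
    have hle : M.gain G n x (δ x) / rejections (δ x) ≤ rejections dt / (rejections dt + 1) + m * q :=
      calc M.gain G n x (δ x) / rejections (δ x)
          ≤ (rejections dt + m * q) / rejections (δ x) := by gcongr
        _ = rejections dt / rejections (δ x) + m * q / rejections (δ x) := add_div _ _ _
        _ ≤ rejections dt / (rejections dt + 1) + m * q := by
            gcongr
            exact div_le_self hq0 (by linarith)
    have : rejections dt / (rejections dt + 1) = 1 - 1 / (rejections dt + 1) := by
      field_simp; ring
    linarith
  · rw [mFDR_of_ne hne]
    have hle : rejections dt / (rejections dt + ((m : ℝ) - m₁)) - m * q ≤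
        M.gain G n x (δ x) / rejections (δ x) :=
      calc rejections dt / (rejections dt + ((m : ℝ) - m₁)) - m * q
          ≤ rejections dt / rejections (δ x) - m * q / rejections (δ x) := by
            gcongr
            exact div_le_self hq0 (one_le_rejections hne)
        _ = (rejections dt - m * q) / rejections (δ x) := (sub_div _ _ _).symm
        _ ≤ M.gain G n x (δ x) / rejections (δ x) := by gcongr
    have hpos : rejections dt + ((m : ℝ) - m₁) ≠ 0 := by linarith
    have : rejections dt / (rejections dt + ((m : ℝ) - m₁)) =
        1 - ((m : ℝ) - m₁) / (rejections dt + ((m : ℝ) - m₁)) := by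
      field_simp; ring
    linarith

end TestingProblem

end BayesTesting

/-! ### The maximal false discovery rate and its asymptotic bounds -/

theorem mainTheorem6 {Ω Ξ ι : Type*} {T : ι → Type*} [MeasurableSpace Ω] [MeasurableSpace Ξ]
    [∀ j, MeasurableSpace (T j)] {m : ℕ} (M : BayesTesting.TestingProblem Ω Ξ T m)
    (𝒢 : ℕ → Set (∀ j, T j)) (hS : M.PosteriorConditions 𝒢)
    (dt : BayesTesting.Decision m) (hdt : M.IsTrueConfig dt)
    (halt : ∀ i, 0 < M.prior (M.alt i) ∧ M.hSet (M.alt i) < ∞)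
    (hdt0 : dt ≠ fun _ => false) (hdt1 : dt ≠ fun _ => true)
    (G : Fin m → Finset (Fin m)) (hG_self : ∀ i, i ∈ G i)
    (hG_symm : ∀ i j, j ∈ G i → i ∈ G j)
    (m₁ : ℕ) (hm₁ : m₁ < m)
    (hG_false : ∀ i : Fin m, (i : ℕ) < m₁ → ∃ j ∈ G i, dt j = true)
    (hG_true : ∀ i : Fin m, m₁ ≤ (i : ℕ) → ∀ j ∈ G i, dt j = false)
    (hG_disj : ∀ i k : Fin m, (i : ℕ) < m₁ → m₁ ≤ (k : ℕ) → Disjoint (G i) (G k))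
    (dhat : ∀ n : ℕ, ℝ → (Fin n → Ξ) → BayesTesting.Decision m)
    (hdhat : M.IsNonMarginal G dhat) :
    ∃ E : ℕ → ℝ,
      (∀ n, IsGreatest ((fun β => M.mpBFDR G n (dhat n β)) '' Ico (0 : ℝ) 1) (E n)) ∧
      ∀ ε : ℝ, 0 < ε → ∀ᶠ n in atTop,
        1 / (BayesTesting.rejections dt + 1) - ε < E n ∧
        E n < ((m : ℝ) - m₁) / (BayesTesting.rejections dt + ((m : ℝ) - m₁)) + ε := by
  have := M.isProb_P
  have hzero : (0 : ℝ) ∈ Ico (0 : ℝ) 1 := ⟨le_rfl, zero_lt_one⟩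
  refine ⟨fun n => M.mpBFDR G n (dhat n 0), fun n => ⟨⟨0, hzero, rfl⟩, ?_⟩, fun ε hε => ?_⟩
  · rintro _ ⟨β, hβ, rfl⟩
    rcases hβ.1.eq_or_lt with rfl | hlt
    · exact le_rfl
    · exact BayesTesting.TestingProblem.mpBFDR_anti hS hdhat n hzero hβ hlt
  obtain ⟨i, hi⟩ := Function.ne_iff.1 hdt1
  have hi : dt i = false := by simpa using hi
  let k : Fin m := ⟨m₁, hm₁⟩
  obtain ⟨b, -, hb⟩ := ENNReal.lt_iff_exists_real_btwn.1 (halt k).2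
  have hD := BayesTesting.rejections_nonneg dt
  have hm : (0 : ℝ) < (m : ℝ) - m₁ := sub_pos.2 (Nat.cast_lt.2 hm₁)
  set q : ℕ → Ω → ℝ := fun n ω => M.posterior n (M.cell dt)ᶜ (M.data n ω) with hq
  -- Half of `ε` absorbs the posterior mass off the true cell, the other half the probability that
  -- the posterior has not yet concentrated.
  have hev : ∀ᵐ ω ∂M.P, ∀ᶠ n in atTop,
      ω ∈ {ω | dhat n 0 (M.data n ω) ≠ fun _ => false} ∧
      1 / (BayesTesting.rejections dt + 1) - ε / 2 ≤ M.mFDR G n (dhat n 0) (M.data n ω) ∧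
      M.mFDR G n (dhat n 0) (M.data n ω) ≤
        ((m : ℝ) - m₁) / (BayesTesting.rejections dt + ((m : ℝ) - m₁)) + ε / 2 := by
    filter_upwards [BayesTesting.TestingProblem.ae_mass_univ_ne_top hS,
      BayesTesting.TestingProblem.ae_exists_le_mass hS (M.measurableSet_alt k) hb.1,
      BayesTesting.TestingProblem.ae_tendsto_posterior_compl_cell hS hdt hi (halt i).1 (halt i).2]
      with ω ht ⟨c, hc0, _, hc⟩ hlim
    have hlim' : Tendsto (fun n => m * q n ω) atTop (𝓝 0) := by
      simpa using hlim.const_mul (m : ℝ)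
    filter_upwards [hc, hlim'.eventually (gt_mem_nhds (show (0 : ℝ) < 1 / 2 by norm_num)),
      hlim'.eventually (gt_mem_nhds (half_pos hε))] with n hn1 hn2 hn3
    have hmass : M.mass n (M.alt k) (M.data n ω) ≠ 0 :=
      ((ENNReal.mul_pos (ENNReal.ofReal_pos.2 (Real.exp_pos _)).ne' hc0).trans_le hn1).ne'
    obtain ⟨h1, h2, h3⟩ := BayesTesting.TestingProblem.mFDR_mem_of_concentrated hdt0 hm₁ hG_self
      hG_symm hG_false hG_true hG_disj (ht n) (le_refl m₁ : m₁ ≤ (k : ℕ)) hmass hn2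
      ((hdhat n 0 hzero).2 (M.data n ω))
    exact ⟨h1, by linarith, by linarith⟩
  have hl : 1 / (BayesTesting.rejections dt + 1) - ε / 2 ≤ 1 := by
    have : 1 / (BayesTesting.rejections dt + 1) ≤ 1 := div_le_one_of_le₀ (by linarith) (by linarith)
    linarith
  have hmain := BayesTesting.eventually_integral_cond_mem
    (fun n => BayesTesting.TestingProblem.measurableSet_ne_false (hdhat n 0 hzero).1)
    (fun n => (BayesTesting.TestingProblem.measurable_mFDR hS G (hdhat n 0 hzero).1).comp
      (M.measurable_data n))
    (fun n ω => M.mFDR_nonneg G n _ _) (fun n ω => M.mFDR_le_one G n _ _) hl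
    (show 0 ≤ ((m : ℝ) - m₁) / (BayesTesting.rejections dt + ((m : ℝ) - m₁)) + ε / 2 by positivity)
    hev (half_pos hε)
  filter_upwards [hmain] with n hn
  exact ⟨lt_of_eq_of_lt (by ring) hn.1, hn.2.trans_eq (by ring)⟩
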